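/- Let $n\ge 1$, $1<q\le p\le q'<\infty$ (where $q'=q/(q-1)$), $0<\rho\le 1$, $m\in\mathbb R$, and $a(\xi)=e^{i|\xi|^{1-\rho}}|\xi|^m$ on $\mathbb R^n$. Let $a(D)f(x)=(2\pi)^{-n}\int_{\mathbb R^n}e^{ix\cdot\xi}a(\xi)\hat f(\xi)\,d\xi$ with $\hat f(\xi)=\int_{\mathbb R^n} e^{-ix\cdot\xi}f(x)\,dx$. For weights $v,w$, we say that $a(D)$ is $L^q(v)$-$L^p(w)$ bounded if there is a finite constant $C$ with $$\Big(\int|a(D)f|^p\,w\,dx\Big)^{1/p}\le C\Big(\int|f|^q\,v\,dx\Big)^{1/q}$$ for all Schwartz functions $f$ for which $a\hat f$ is integrable (for $m>-n$: all Schwartz functions). Then the following hold. (i) Let $\gamma\in[1,\infty)$. If $a(D)$ is $L^q(|x|^{qs})$-$L^p(|x|^{ps})$ bounded for every $s\in(-n/\gamma,0)$ (with a constant that may depend on $s$), then $$m\le -n(1-\rho)\Big(\frac12-\frac1p\Big)-\rho n\Big(\frac1q-\frac1p\Big)-\frac{n(1-\rho)}{\gamma}.$$ (ii) Let $r\in[1,q)$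 and $t=(p/q)(r'/p)'$, where $'$ denotes the conjugate exponent (for $r=1$, $r'=\infty$ and $(r'/p)'=1$). If $a(D)$ is $L^q(\omega^q)$-$L^p(\omega^p)$ bounded for every $\omega\ge0$ with $\omega^q\in RH_t$ (with a constant that may depend on $\omega$), then $$m\le -n(1-\rho)\Big(\frac1r-\frac12\Big)-\rho n\Big(\frac1q-\frac1p\Big).$$ Here $RH_t$ is the class of locally integrable, almost everywhere positive functions $w$ with $$\sup_Q\Big(\frac1{|Q|}\int_Q w\Big)^{-1}\Big(\frac1{|Q|}\int_Q w^t\Big)^{1/t}<\infty,$$ the supremum being over all cubes $Q\subset\mathbb R^n$ with sides parallel to the axes. -/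

import Mathlib

open MeasureTheory FourierTransform SchwartzMap
open scoped ENNReal NNReal

noncomputable section

/-- The space `ℝⁿ` with its Euclidean norm. -/
abbrev Rn (n : ℕ) : Type := EuclideanSpace ℝ (Fin n)

/-- The Fourier transform `f̂(ξ) = ∫ e^{-i x·ξ} f(x) dx`; Mathlib's `𝓕` has the kernel
`e^{-2πi x·ξ}`, whence the rescaling (see `angularFourier_eq`). -/
def angularFourier {n : ℕ} (f : Rn n → ℂ) (ξ : Rn n) : ℂ :=
  𝓕 f ((2 * Real.pi)⁻¹ • ξ)

theorem angularFourier_eq {n : ℕ} (f : Rn n → ℂ) (ξ : Rn n) :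
    angularFourier f ξ =
      ∫ x : Rn n, Complex.exp (-(Complex.I * ((inner ℝ x ξ : ℝ) : ℂ))) * f x := by
  unfold angularFourier
  rw [Real.fourier_eq']
  congr 1
  ext x
  rw [smul_eq_mul, real_inner_smul_right]
  congr 2
  have : (Real.pi : ℂ) ≠ 0 := by exact_mod_cast Real.pi_ne_zero
  push_cast
  field_simp

/-- The operator `a(D)`:
`a(D) f (x) = (2π)^{-n} ∫ e^{i x·ξ} a(ξ) f̂(ξ) dξ`. -/
def multiplierOp {n : ℕ} (a : Rn n → ℂ) (f : Rn n → ℂ) (x : Rn n) : ℂ :=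
  (((2 * Real.pi) ^ n)⁻¹ : ℝ) *
    ∫ ξ : Rn n, Complex.exp (Complex.I * ((inner ℝ x ξ : ℝ) : ℂ)) * (a ξ * angularFourier f ξ)

/-- The symbol `a(ξ) = e^{i|ξ|^{1-ρ}} |ξ|^m`. -/
def oscSymbol (n : ℕ) (ρ m : ℝ) (ξ : Rn n) : ℂ :=
  Complex.exp (Complex.I * ((‖ξ‖ ^ (1 - ρ) : ℝ) : ℂ)) * ((‖ξ‖ ^ m : ℝ) : ℂ)

/-- The norm of the weighted space `L^p(w)`, that is `(∫ |f|^p w dx)^{1/p}`. -/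
def weightedNorm {n : ℕ} (p : ℝ) (w : Rn n → ℝ) (f : Rn n → ℂ) : ℝ≥0∞ :=
  eLpNorm f (ENNReal.ofReal p) (volume.withDensity fun x => ENNReal.ofReal (w x))

/-- `L^q(v)`-`L^p(w)` boundedness of `a(D)`: the estimate `‖a(D) f‖_{L^p(w)} ≤ C ‖f‖_{L^q(v)}`
for all Schwartz functions `f` for which the integral defining `a(D) f` converges absolutely
(for symbols that are locally integrable and of polynomial growth: all Schwartz functions). -/
def IsWeightedBounded {n : ℕ} (a : Rn n → ℂ) (q p : ℝ) (v w : Rn n → ℝ) : Prop :=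
  ∃ C : ℝ≥0, ∀ f : 𝓢(Rn n, ℂ), Integrable (fun ξ => a ξ * angularFourier f ξ) →
    weightedNorm p w (multiplierOp a f) ≤ C * weightedNorm q v f

/-- The cube with sides of length `ℓ` parallel to the axes and lowest corner `c`. -/
def cube {n : ℕ} (c : Rn n) (ℓ : ℝ) : Set (Rn n) :=
  {x | ∀ i, x i ∈ Set.Icc (c i) (c i + ℓ)}

/-- `⟨w⟩_{t,Q} = (|Q|⁻¹ ∫_Q w^t)^{1/t}` for a nonnegative function `w`. -/
def cubeMean {n : ℕ} (t : ℝ) (w : Rn n → ℝ) (Q : Set (Rn n)) : ℝ≥0∞ :=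
  ((volume Q)⁻¹ * ∫⁻ x in Q, ENNReal.ofReal (w x) ^ t) ^ (1 / t)

/-- The constant `[w]_{RH_t} = sup_Q ⟨w⟩_{1,Q}⁻¹ ⟨w⟩_{t,Q}`, over all cubes `Q`. -/
def rhConstant {n : ℕ} (t : ℝ) (w : Rn n → ℝ) : ℝ≥0∞ :=
  ⨆ (c : Rn n) (ℓ : ℝ) (_ : 0 < ℓ), (cubeMean 1 w (cube c ℓ))⁻¹ * cubeMean t w (cube c ℓ)

/-- The reverse Hölder class `RH_t` of weights. A weight is a locally integrable function that
is positive almost everywhere. -/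
structure IsReverseHolder {n : ℕ} (t : ℝ) (w : Rn n → ℝ) : Prop where
  locallyIntegrable : LocallyIntegrable w
  pos : ∀ᵐ x, 0 < w x
  finite : rhConstant t w < ∞

/-- The exponent `(p/q)(r'/p)'`, computed in `[0,∞]` because `r' = ∞` for `r = 1`
(and then `(r'/p)' = 1`). -/
def rhExponent (p q r : ℝ) : ℝ :=
  p / q * (ENNReal.conjExponent
    (ENNReal.conjExponent (ENNReal.ofReal r) / ENNReal.ofReal p)).toReal

end

/-!
The operator is tested on packets `F_R`, written at unit scale and dilated to frequency `R`, whose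
Fourier transform is `e^{-iφ/σ} T_σ^k χ`. Here `σ = R^{ρ-1}`, `φ = |·|^{1-ρ}` on the support of the
bump `χ`, and `T_σ = σ∂_v - i(∂_vφ)` is the conjugate of `σ∂_v` under `e^{-iφ/σ}`. The phase of the
symbol at frequency `R` is `e^{iφ/σ}`, so it cancels: `a(D)` sends `F_R` to `R^m` times a bump whose
size stays bounded below, since `T_σ → T_{σ₀}` along `R → ∞` and the limit is nonzero. The input,
on the other hand, is spread over the relative scale `σ⁻¹`, and it vanishes to order `k` at the
origin, which makes negative powers of `|x|` harmless; its `L^q(|x|^{qs})` norm is at most a power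
of `R`. Comparing powers of `R` bounds `m` for each single `s`, and (i) is the limit `s → -n/γ`.

For (ii), `|x|^{qs}` belongs to `RH_t` whenever `-n < qst` and `s ≤ 0`, so (i) applies with
`γ = qt = (1/p + 1/r - 1)⁻¹`.
-/

open LineDeriv
open scoped Topology

section TwistedDerivative

variable {V : Type*} [NormedAddCommGroup V] [NormedSpace ℝ V]

theorem hasTemperateGrowth_exp_neg_I_mul :
    (fun t : ℝ => Complex.exp (-Complex.I * t)).HasTemperateGrowth := by
  have hderiv (k : ℕ) : iteratedDeriv k (fun t : ℝ => Complex.exp (-Complex.I * t)) =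
      fun t : ℝ => (-Complex.I) ^ k * Complex.exp (-Complex.I * t) := by
    induction k with
    | zero => simp
    | succ k ih =>
      ext t
      have h := ((((hasDerivAt_id (t : ℂ)).const_mul (-Complex.I)).cexp).comp_ofReal).const_mul
        ((-Complex.I) ^ k)
      rw [iteratedDeriv_succ, ih]
      exact h.deriv.trans (by simp only [id_eq]; ring)
  refine ⟨(contDiff_const.mul Complex.ofRealCLM.contDiff).cexp, fun k => ⟨0, 1, fun t => ?_⟩⟩
  rw [norm_iteratedFDeriv_eq_norm_iteratedDeriv, hderiv]
  simp [Complex.norm_exp]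

/-- The operator of multiplication by the oscillating factor `e^{-iτφ}` on Schwartz functions. -/
noncomputable def oscMul (φ : 𝓢(V, ℝ)) (τ : ℝ) : 𝓢(V, ℂ) →L[ℂ] 𝓢(V, ℂ) :=
  smulLeftCLM ℂ fun η => Complex.exp (-Complex.I * (τ * φ η : ℝ))

theorem oscMul_apply (φ : 𝓢(V, ℝ)) (τ : ℝ) (g : 𝓢(V, ℂ)) (η : V) :
    oscMul φ τ g η = Complex.exp (-Complex.I * (τ * φ η : ℝ)) * g η :=
  smulLeftCLM_apply_apply (hasTemperateGrowth_exp_neg_I_mul.comp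
    ((Function.HasTemperateGrowth.const τ).mul φ.hasTemperateGrowth)) g η

theorem norm_oscMul_apply (φ : 𝓢(V, ℝ)) (τ : ℝ) (g : 𝓢(V, ℂ)) (η : V) :
    ‖oscMul φ τ g η‖ = ‖g η‖ := by
  simp [oscMul_apply, Complex.norm_exp]

/-- The operator `σ∂_v - i(∂_vφ)`. For `σ ≠ 0` it is the conjugate of `σ∂_v` under multiplication
by `e^{-iφ/σ}`; unlike that conjugate, it also makes sense at the semiclassical limit `σ = 0`. -/
noncomputable def twistedDeriv (φ : 𝓢(V, ℝ)) (v : V) (σ : ℝ) (g : 𝓢(V, ℂ)) : 𝓢(V, ℂ) :=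
  σ • ∂_{v} g + smulLeftCLM ℂ (fun η => -Complex.I * (∂_{v} φ η : ℝ)) g

theorem twistedDeriv_apply (φ : 𝓢(V, ℝ)) (v : V) (σ : ℝ) (g : 𝓢(V, ℂ)) (η : V) :
    twistedDeriv φ v σ g η = σ * ∂_{v} g η - Complex.I * (∂_{v} φ η : ℝ) * g η := by
  have hφ : (fun η => -Complex.I * (∂_{v} φ η : ℝ)).HasTemperateGrowth :=
    (Function.HasTemperateGrowth.const _).mul
      (Function.Complex.hasTemperateGrowth_ofReal.comp (∂_{v} φ).hasTemperateGrowth)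
  simp only [twistedDeriv, add_apply, smul_apply, smulLeftCLM_apply_apply hφ, smul_eq_mul,
    Complex.real_smul]
  ring

theorem smul_lineDerivOp_oscMul (φ : 𝓢(V, ℝ)) (v : V) {σ : ℝ} (hσ : σ ≠ 0) (g : 𝓢(V, ℂ)) :
    σ • ∂_{v} (oscMul φ σ⁻¹ g) = oscMul φ σ⁻¹ (twistedDeriv φ v σ g) := by
  ext η
  have hφ : HasFDerivAt (fun η => ((σ⁻¹ * φ η : ℝ) : ℂ))
      (Complex.ofRealCLM ∘L (σ⁻¹ • fderiv ℝ φ η)) η :=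
    Complex.ofRealCLM.hasFDerivAt.comp η ((φ.hasFDerivAt η).const_mul σ⁻¹)
  have h := ((hφ.const_mul (-Complex.I)).cexp.mul (g.hasFDerivAt η)).congr_of_eventuallyEq
    (.of_forall (oscMul_apply φ σ⁻¹ g))
  rw [smul_apply, lineDerivOp_apply_eq_fderiv, h.fderiv, oscMul_apply, twistedDeriv_apply,
    lineDerivOp_apply_eq_fderiv, lineDerivOp_apply_eq_fderiv]
  have : (σ : ℂ) ≠ 0 := by exact_mod_cast hσ
  simp
  field_simp
  ring

theorem continuous_twistedDeriv {X : Type*} [TopologicalSpace X] (φ : 𝓢(V, ℝ)) (v : V)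
    {σ : X → ℝ} {g : X → 𝓢(V, ℂ)} (hσ : Continuous σ) (hg : Continuous g) :
    Continuous fun x => twistedDeriv φ v (σ x) (g x) :=
  (hσ.smul ((lineDerivOpCLM ℂ 𝓢(V, ℂ) v).continuous.comp hg)).add
    ((smulLeftCLM ℂ _).continuous.comp hg)

theorem continuous_iterate_twistedDeriv (φ : 𝓢(V, ℝ)) (v : V) (k : ℕ) (g : 𝓢(V, ℂ)) :
    Continuous fun σ => (twistedDeriv φ v σ)^[k] g := by
  induction k with
  | zero => exact continuous_const
  | succ k ih =>
    simp only [Function.iterate_succ_apply']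
    exact continuous_twistedDeriv φ v continuous_id ih

theorem support_iterate_twistedDeriv_subset (φ : 𝓢(V, ℝ)) (v : V) (σ : ℝ) (k : ℕ) (g : 𝓢(V, ℂ)) :
    Function.support ((twistedDeriv φ v σ)^[k] g) ⊆ tsupport g := by
  refine (subset_tsupport _).trans ?_
  induction k with
  | zero => exact subset_rfl
  | succ k ih =>
    rw [Function.iterate_succ_apply']
    refine (tsupport_add _ _).trans (Set.union_subset ?_ ?_)
    · exact ((tsupport_smul_subset_right (fun _ => σ) _).trans
        (tsupport_lineDerivOp_subset v _)).trans ih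
    · exact ((tsupport_smulLeftCLM_subset _ _).trans Set.inter_subset_left).trans ih

theorem iterate_twistedDeriv_zero_apply (φ : 𝓢(V, ℝ)) (v : V) (k : ℕ) (g : 𝓢(V, ℂ)) (η : V) :
    (twistedDeriv φ v 0)^[k] g η = (-Complex.I * (∂_{v} φ η : ℝ)) ^ k * g η := by
  induction k with
  | zero => simp
  | succ k ih =>
    rw [Function.iterate_succ_apply', twistedDeriv_apply, ih]
    push_cast
    ring

theorem lineDerivOp_injective {v : V} (hv : v ≠ 0) :
    Function.Injective (lineDerivOp v : 𝓢(V, ℂ) → 𝓢(V, ℂ)) := by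
  refine (injective_iff_map_eq_zero (lineDerivOpCLM ℂ 𝓢(V, ℂ) v)).mpr fun f hf => ?_
  ext x
  have hconst (t : ℝ) : f (x + t • v) = f x := by
    have hderiv (t : ℝ) : HasDerivAt (fun t : ℝ => f (x + t • v)) 0 t := by
      have h := (f.hasFDerivAt (x + t • v)).comp_hasDerivAt t
        (((hasDerivAt_id t).smul_const v).const_add x)
      rwa [one_smul, ← lineDerivOp_apply_eq_fderiv, show ∂_{v} f = 0 from hf] at h
    simpa using is_const_of_deriv_eq_zero (fun t => (hderiv t).differentiableAt)
      (fun t => (hderiv t).deriv) t 0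
  have hline : Filter.Tendsto (fun t : ℝ => ‖x + t • v‖) Filter.atTop Filter.atTop := by
    refine Filter.tendsto_atTop_mono (f := fun t : ℝ => |t| * ‖v‖ + -‖x‖) (fun t => ?_)
      (Filter.tendsto_atTop_add_const_right _ _
        (Filter.tendsto_abs_atTop_atTop.atTop_mul_const (norm_pos_iff.mpr hv)))
    have h := norm_sub_le (x + t • v) x
    rw [add_sub_cancel_left, norm_smul, Real.norm_eq_abs] at h
    linarith
  obtain ⟨C, -, hC⟩ := f.decay 1 0
  by_contra hx
  obtain ⟨t, ht⟩ := (hline.eventually_gt_atTop (C / ‖f x‖)).exists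
  rw [div_lt_iff₀ (norm_pos_iff.mpr hx)] at ht
  have := hC (x + t • v)
  rw [pow_one, norm_iteratedFDeriv_zero, hconst] at this
  exact this.not_gt ht

theorem twistedDeriv_injective (φ : 𝓢(V, ℝ)) {v : V} (hv : v ≠ 0) {σ : ℝ} (hσ : σ ≠ 0) :
    Function.Injective (twistedDeriv φ v σ) := by
  intro g₁ g₂ h
  have h₁ := congrArg (oscMul φ σ⁻¹) h
  rw [← smul_lineDerivOp_oscMul φ v hσ, ← smul_lineDerivOp_oscMul φ v hσ] at h₁
  have h₂ := lineDerivOp_injective hv (smul_right_injective _ hσ h₁)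
  ext η
  simpa [oscMul_apply, Complex.exp_ne_zero] using congrArg (· η) h₂

end TwistedDerivative

section UniformDecay

variable {V : Type*} [NormedAddCommGroup V] [InnerProductSpace ℝ V] [FiniteDimensional ℝ V]
  [MeasurableSpace V] [BorelSpace V]

theorem eLpNorm_fourierInv_two (f : 𝓢(V, ℂ)) : eLpNorm (𝓕⁻ f : 𝓢(V, ℂ)) 2 = eLpNorm f 2 := by
  have h := norm_fourier_toL2_eq (𝓕⁻ f)
  rw [fourier_fourierInv_eq, norm_toLp, norm_toLp] at h
  exact ((ENNReal.toReal_eq_toReal_iff' (f.memLp 2 volume).eLpNorm_ne_top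
    ((𝓕⁻ f).memLp 2 volume).eLpNorm_ne_top).mp h).symm

theorem norm_fourierInv_oscMul_twistedDeriv (φ : 𝓢(V, ℝ)) (v : V) {σ : ℝ} (hσ : σ ≠ 0)
    (g : 𝓢(V, ℂ)) (x : V) :
    ‖𝓕⁻ (oscMul φ σ⁻¹ (twistedDeriv φ v σ g)) x‖ =
      2 * Real.pi * |inner ℝ (σ • x) v| * ‖𝓕⁻ (oscMul φ σ⁻¹ g) x‖ := by
  have hv : (fun x : V => inner ℝ x v).HasTemperateGrowth := by fun_prop
  rw [← smul_lineDerivOp_oscMul φ v hσ, FourierTransform.fourierInv_smul,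
    fourierInv_lineDerivOp_eq]
  simp [smulLeftCLM_apply_apply hv, real_inner_smul_left, abs_of_pos Real.pi_pos]
  ring

theorem norm_fourierInv_oscMul_iterate_twistedDeriv (φ : 𝓢(V, ℝ)) (v : V) {σ : ℝ} (hσ : σ ≠ 0)
    (k : ℕ) (g : 𝓢(V, ℂ)) (x : V) :
    ‖𝓕⁻ (oscMul φ σ⁻¹ ((twistedDeriv φ v σ)^[k] g)) x‖ =
      (2 * Real.pi * |inner ℝ (σ • x) v|) ^ k * ‖𝓕⁻ (oscMul φ σ⁻¹ g) x‖ := by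
  induction k with
  | zero => simp
  | succ k ih =>
    rw [Function.iterate_succ_apply', norm_fourierInv_oscMul_twistedDeriv φ v hσ, ih]
    ring

theorem one_add_norm_smul_mul_norm_fourierInv_oscMul_le {ι : Type*} [Fintype ι]
    (b : OrthonormalBasis ι ℝ V) (φ : 𝓢(V, ℝ)) {σ : ℝ} (hσ : σ ≠ 0) (g : 𝓢(V, ℂ)) (x : V) :
    (1 + ‖σ • x‖) * ‖𝓕⁻ (oscMul φ σ⁻¹ g) x‖ ≤ ‖𝓕⁻ (oscMul φ σ⁻¹ g) x‖ +
      ∑ i, ‖𝓕⁻ (oscMul φ σ⁻¹ (twistedDeriv φ (b i) σ g)) x‖ := by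
  have hnorm : ‖σ • x‖ ≤ ∑ i, 2 * Real.pi * |inner ℝ (σ • x) (b i)| := by
    calc ‖σ • x‖ = ‖∑ i, inner ℝ (b i) (σ • x) • b i‖ := by rw [b.sum_repr']
      _ ≤ ∑ i, ‖inner ℝ (b i) (σ • x) • b i‖ := norm_sum_le _ _
      _ ≤ _ := by
        gcongr with i
        rw [norm_smul, b.norm_eq_one, mul_one, Real.norm_eq_abs, real_inner_comm]
        exact le_mul_of_one_le_left (abs_nonneg _) (by linarith [Real.pi_gt_three])
  simp only [norm_fourierInv_oscMul_twistedDeriv φ _ hσ]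
  rw [add_mul, one_mul, ← Finset.sum_mul]
  gcongr

theorem exists_eLpNorm_two_le_of_continuous {g : ℝ → 𝓢(V, ℂ)} (hg : Continuous g) :
    ∃ C : ℝ≥0, ∀ σ ∈ Set.Icc (0 : ℝ) 1, eLpNorm (g σ) 2 ≤ C := by
  obtain ⟨C, hC⟩ := isCompact_Icc.exists_bound_of_continuousOn
    ((continuous_toLp (μ := (volume : Measure V)) (p := 2)).comp hg).continuousOn
  refine ⟨C.toNNReal, fun σ hσ => ?_⟩
  have h : (eLpNorm (g σ) 2).toReal ≤ C := norm_toLp.symm.trans_le (hC σ hσ)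
  exact (ENNReal.le_ofReal_iff_toReal_le ((g σ).memLp 2 volume).eLpNorm_ne_top
    (ENNReal.toReal_nonneg.trans h)).mpr h

/-- Each power of `1 + ‖σx‖` costs a twisted derivative, which stays within continuous families;
this is why the family `g` is quantified over. -/
theorem exists_eLpNorm_two_one_add_norm_pow_smul_le (φ : 𝓢(V, ℝ)) (N : ℕ) {g : ℝ → 𝓢(V, ℂ)}
    (hg : Continuous g) :
    ∃ C : ℝ≥0, ∀ σ ∈ Set.Ioc (0 : ℝ) 1,
      eLpNorm (fun x => (1 + ‖σ • x‖) ^ N • 𝓕⁻ (oscMul φ σ⁻¹ (g σ)) x) 2 volume ≤ C := by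
  induction N generalizing g with
  | zero =>
    obtain ⟨C, hC⟩ := exists_eLpNorm_two_le_of_continuous hg
    refine ⟨C, fun σ hσ => ?_⟩
    simp only [pow_zero, one_smul]
    rw [eLpNorm_fourierInv_two, eLpNorm_congr_norm_ae (.of_forall (norm_oscMul_apply φ σ⁻¹ (g σ)))]
    exact hC σ ⟨hσ.1.le, hσ.2⟩
  | succ N ih =>
    let b := stdOrthonormalBasis ℝ V
    obtain ⟨C₀, hC₀⟩ := ih hg
    choose C hC using fun i => ih (continuous_twistedDeriv φ (b i) continuous_id hg)
    refine ⟨C₀ + ∑ i, C i, fun σ hσ => ?_⟩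
    let F (g : 𝓢(V, ℂ)) (x : V) : ℝ := ‖(1 + ‖σ • x‖) ^ N • 𝓕⁻ (oscMul φ σ⁻¹ g) x‖
    have F_apply (g : 𝓢(V, ℂ)) (x : V) :
        F g x = (1 + ‖σ • x‖) ^ N * ‖𝓕⁻ (oscMul φ σ⁻¹ g) x‖ :=
      (norm_smul _ _).trans (by rw [Real.norm_of_nonneg (by positivity)])
    have hF (g : 𝓢(V, ℂ)) : AEStronglyMeasurable (F g) volume :=
      Continuous.aestronglyMeasurable (by
        have := (𝓕⁻ (oscMul φ σ⁻¹ g)).continuous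
        fun_prop)
    calc _ ≤ eLpNorm (F (g σ) + ∑ i, F (twistedDeriv φ (b i) σ (g σ))) 2 volume := by
          refine eLpNorm_mono_real fun x => ?_
          have h := one_add_norm_smul_mul_norm_fourierInv_oscMul_le b φ hσ.1.ne' (g σ) x
          have h' := mul_le_mul_of_nonneg_left h (by positivity : 0 ≤ (1 + ‖σ • x‖) ^ N)
          rw [norm_smul, Real.norm_of_nonneg (by positivity), pow_succ, mul_assoc]
          simpa only [Pi.add_apply, Finset.sum_apply, F_apply, mul_add, Finset.mul_sum] using h'
      _ ≤ eLpNorm (F (g σ)) 2 volume +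
            ∑ i, eLpNorm (F (twistedDeriv φ (b i) σ (g σ))) 2 volume :=
          (eLpNorm_add_le (hF _) (Finset.aestronglyMeasurable_sum _ fun i _ => hF _)
            one_le_two).trans (by gcongr; exact eLpNorm_sum_le (fun i _ => hF _) one_le_two)
      _ ≤ _ := by
          simp only [F, eLpNorm_norm]
          push_cast
          gcongr with i
          exacts [hC₀ σ hσ, hC i σ hσ]

end UniformDecay

section PowerWeights

theorem rpow_mul_pow_le_one_add_pow {t s : ℝ} {k : ℕ} (ht : 0 ≤ t) (hs : 0 ≤ s + k) :
    t ^ s * t ^ k ≤ (1 + t) ^ ⌈s + k⌉₊ := by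
  rcases ht.eq_or_lt with rfl | ht
  · rw [add_zero, one_pow]
    exact mul_le_one₀ (Real.zero_rpow_le_one s) (by positivity) (zero_pow_le_one k)
  · calc t ^ s * t ^ k = t ^ (s + k) := by rw [Real.rpow_add ht, Real.rpow_natCast]
      _ ≤ (1 + t) ^ (s + k) := by gcongr; linarith
      _ ≤ (1 + t) ^ (⌈s + k⌉₊ : ℝ) :=
        Real.rpow_le_rpow_of_exponent_le (by linarith) (Nat.le_ceil _)
      _ = (1 + t) ^ ⌈s + k⌉₊ := Real.rpow_natCast _ _

variable {V : Type*} [NormedAddCommGroup V] [NormedSpace ℝ V] [FiniteDimensional ℝ V]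
  [MeasurableSpace V] [BorelSpace V] (μ : Measure V) [μ.IsAddHaarMeasure]
  {E : Type*} [NormedAddCommGroup E]

theorem eLpNorm_comp_smul {p : ℝ} (hp : 0 < p) (f : V → E) {c : ℝ} (hc : 0 < c) :
    eLpNorm (fun x => f (c • x)) (ENNReal.ofReal p) μ =
      ENNReal.ofReal (c ^ (-(Module.finrank ℝ V : ℝ) / p)) * eLpNorm f (ENNReal.ofReal p) μ := by
  have hemb : MeasurableEmbedding fun x : V => c • x :=
    (Homeomorph.smulOfNeZero c hc.ne').measurableEmbedding
  have hconst : ENNReal.ofReal |(c ^ Module.finrank ℝ V)⁻¹| ^ (1 / ENNReal.ofReal p).toReal =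
      ENNReal.ofReal (c ^ (-(Module.finrank ℝ V : ℝ) / p)) := by
    rw [abs_of_pos (by positivity), ENNReal.toReal_div, ENNReal.toReal_one,
      ENNReal.toReal_ofReal hp.le, ENNReal.ofReal_rpow_of_pos (by positivity), ← Real.rpow_natCast,
      ← Real.rpow_neg hc.le, ← Real.rpow_mul hc.le, mul_one_div]
  rw [← hconst, ← smul_eq_mul, ← eLpNorm_smul_measure_of_ne_top ENNReal.ofReal_ne_top,
    ← Measure.map_addHaar_smul μ hc.ne', hemb.eLpNorm_map_measure]
  rfl

variable [NormedSpace ℝ E]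

theorem eLpNorm_norm_rpow_smul_comp_smul {p : ℝ} (hp : 0 < p) (s : ℝ) (f : V → E) {c : ℝ}
    (hc : 0 < c) :
    eLpNorm (fun x => ‖x‖ ^ s • f (c • x)) (ENNReal.ofReal p) μ =
      ENNReal.ofReal (c ^ (-(Module.finrank ℝ V : ℝ) / p - s)) *
        eLpNorm (fun x => ‖x‖ ^ s • f x) (ENNReal.ofReal p) μ := by
  have hdilate : (fun x => ‖x‖ ^ s • f (c • x)) =
      c ^ (-s) • fun x => ‖c • x‖ ^ s • f (c • x) := by
    ext x
    rw [Pi.smul_apply, norm_smul, Real.norm_of_nonneg hc.le, Real.mul_rpow hc.le (norm_nonneg x),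
      smul_smul, ← mul_assoc, ← Real.rpow_add hc, neg_add_cancel, Real.rpow_zero, one_mul]
  rw [hdilate, eLpNorm_const_smul, eLpNorm_comp_smul μ hp (fun x => ‖x‖ ^ s • f x) hc, ← mul_assoc,
    Real.enorm_of_nonneg (by positivity), ← ENNReal.ofReal_mul (by positivity),
    ← Real.rpow_add hc, neg_add_eq_sub]

theorem exists_eLpNorm_norm_rpow_smul_le {q : ℝ≥0∞} (hq : q ≤ 2) {s : ℝ} {k : ℕ}
    (hs : 0 ≤ s + k) :
    ∃ (N : ℕ) (C : ℝ≥0), ∀ F G : V → E, AEStronglyMeasurable G μ →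
      (∀ x, ‖F x‖ ≤ ‖x‖ ^ k * ‖G x‖) →
      eLpNorm (fun x => ‖x‖ ^ s • F x) q μ ≤
        C * eLpNorm (fun x => (1 + ‖x‖) ^ N • G x) 2 μ := by
  let r : ℝ≥0∞ := (q⁻¹ - 2⁻¹)⁻¹
  have : ENNReal.HolderTriple r 2 q :=
    ⟨by rw [inv_inv, tsub_add_cancel_of_le (ENNReal.inv_le_inv.mpr hq)]⟩
  obtain ⟨j, hj⟩ := Measure.HasTemperateGrowth.exists_eLpNorm_lt_top r (μ := μ) inferInstance
  refine ⟨j + ⌈s + k⌉₊, (eLpNorm (fun x : V => (1 + ‖x‖) ^ (-j : ℝ)) r μ).toNNReal,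
    fun F G hG hF => ?_⟩
  rw [ENNReal.coe_toNNReal hj.ne]
  refine le_trans (eLpNorm_mono fun x => ?_) (eLpNorm_smul_le_mul_eLpNorm
    (((by fun_prop : Continuous fun x : V => (1 + ‖x‖) ^ (j + ⌈s + k⌉₊)).aestronglyMeasurable).smul
      hG) (by fun_prop : Measurable fun x : V => (1 + ‖x‖) ^ (-j : ℝ)).aestronglyMeasurable)
  have hpos : 0 < 1 + ‖x‖ := by positivity
  calc ‖‖x‖ ^ s • F x‖ ≤ ‖x‖ ^ s * (‖x‖ ^ k * ‖G x‖) := by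
        rw [norm_smul, Real.norm_of_nonneg (by positivity)]
        gcongr
        exact hF x
    _ ≤ (1 + ‖x‖) ^ ⌈s + k⌉₊ * ‖G x‖ := by
        rw [← mul_assoc]
        gcongr
        exact rpow_mul_pow_le_one_add_pow (norm_nonneg x) hs
    _ = _ := by
        rw [Pi.smul_apply', Pi.smul_apply', smul_smul, norm_smul,
          Real.norm_of_nonneg (by positivity), pow_add, ← mul_assoc, Real.rpow_neg hpos.le,
          Real.rpow_natCast, inv_mul_cancel₀ (by positivity), one_mul]

theorem eLpNorm_indicator_norm_rpow_ne_zero [Nontrivial V] {p : ℝ≥0∞} (hp : p ≠ 0) (s : ℝ) {A : ℝ}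
    (hA : A ≠ 0) {S : Set V} (hS : MeasurableSet S) (hμS : μ S ≠ 0) :
    eLpNorm (S.indicator fun x => ‖x‖ ^ s * A) p μ ≠ 0 := by
  have hmeas : Measurable fun x : V => ‖x‖ ^ s * A := by fun_prop
  rw [Ne, eLpNorm_eq_zero_iff (hmeas.indicator hS).aestronglyMeasurable hp,
    Set.indicator_ae_eq_zero]
  refine fun h => hμS (measure_mono_null_ae ?_ h)
  filter_upwards [compl_mem_ae_iff.mpr (measure_singleton (0 : V))] with x hx0 hxS
  have : 0 < ‖x‖ := norm_pos_iff.mpr hx0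
  exact ⟨hxS, mul_ne_zero (by positivity) hA⟩

theorem exists_eventually_le_eLpNorm_norm_rpow_smul [Nontrivial V] {p : ℝ≥0∞} (hp : p ≠ 0) (s : ℝ)
    {X : Type*} [TopologicalSpace X] {g : X → 𝓢(V, E)} (hg : Continuous g) {σ₀ : X}
    (h₀ : g σ₀ ≠ 0) :
    ∃ κ : ℝ≥0∞, κ ≠ 0 ∧ ∀ᶠ σ in 𝓝 σ₀, κ ≤ eLpNorm (fun x => ‖x‖ ^ s • g σ x) p μ := by
  obtain ⟨x₀, hx₀⟩ := DFunLike.ne_iff.mp h₀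
  have hcont : Continuous fun z : X × V => ‖g z.1 z.2‖ :=
    ((((toBoundedContinuousFunctionCLM ℝ V E).continuous.comp hg).comp continuous_fst).eval
      continuous_snd).norm
  have hpos : 0 < ‖g σ₀ x₀‖ := norm_pos_iff.mpr hx₀
  obtain ⟨U, hU, S, hS, hUS⟩ := mem_nhds_prod_iff.mp
    (hcont.continuousAt.eventually (lt_mem_nhds (half_lt_self hpos) : _ ∈ 𝓝 ‖g σ₀ x₀‖))
  obtain ⟨δ, hδ, hδS⟩ := Metric.mem_nhds_iff.mp hS
  refine ⟨_, eLpNorm_indicator_norm_rpow_ne_zero μ hp s (half_pos hpos).ne' measurableSet_ball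
    (Metric.measure_ball_pos μ x₀ hδ).ne', Filter.eventually_of_mem hU fun σ hσ =>
    eLpNorm_mono fun x => ?_⟩
  by_cases hx : x ∈ Metric.ball x₀ δ
  · rw [Set.indicator_of_mem hx, norm_mul, norm_smul, Real.norm_of_nonneg (half_pos hpos).le]
    gcongr
    exact (hUS (Set.mk_mem_prod hσ (hδS hx)) : _ < _).le
  · rw [Set.indicator_of_notMem hx, norm_zero]
    exact norm_nonneg _

end PowerWeights

section WavePacket

variable {V : Type*} [NormedAddCommGroup V] [InnerProductSpace ℝ V] [FiniteDimensional ℝ V]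
  [MeasurableSpace V] [BorelSpace V]

/-- The test functions: the inverse Fourier transform of `e^{-iφ/σ} T^k g` for the twisted
derivative `T`, which is that of the `k`-th derivative `(σ∂_v)^k (e^{-iφ/σ} g)` and so vanishes to
order `k` at the origin. -/
noncomputable def wavePacket (φ : 𝓢(V, ℝ)) (v : V) (k : ℕ) (g : 𝓢(V, ℂ)) (σ : ℝ) : 𝓢(V, ℂ) :=
  𝓕⁻ (oscMul φ σ⁻¹ ((twistedDeriv φ v σ)^[k] g))

theorem norm_wavePacket_le (φ : 𝓢(V, ℝ)) (v : V) {σ : ℝ} (hσ : σ ≠ 0)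
    (k : ℕ) (g : 𝓢(V, ℂ)) (x : V) :
    ‖wavePacket φ v k g σ x‖ ≤
      ‖σ • x‖ ^ k * ‖𝓕⁻ (oscMul φ σ⁻¹ ((2 * Real.pi * ‖v‖) ^ k • g)) x‖ := by
  rw [wavePacket, norm_fourierInv_oscMul_iterate_twistedDeriv φ v hσ,
    (oscMul φ σ⁻¹).map_smul_of_tower, FourierTransform.fourierInv_smul, smul_apply,
    norm_smul (_ ^ k) _, Real.norm_of_nonneg (by positivity), ← mul_assoc, ← mul_pow]
  refine mul_le_mul_of_nonneg_right (pow_le_pow_left₀ (by positivity) ?_ k) (norm_nonneg _)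
  calc 2 * Real.pi * |inner ℝ (σ • x) v| ≤ 2 * Real.pi * (‖σ • x‖ * ‖v‖) := by
        gcongr
        exact abs_real_inner_le_norm _ _
    _ = ‖σ • x‖ * (2 * Real.pi * ‖v‖) := by ring

theorem exists_eLpNorm_norm_rpow_smul_wavePacket_le (φ : 𝓢(V, ℝ)) (v : V) (g : 𝓢(V, ℂ))
    {q : ℝ} (hq0 : 0 < q) (hq2 : q ≤ 2) {s : ℝ} {k : ℕ} (hs : 0 ≤ s + k) :
    ∃ C : ℝ≥0, ∀ σ ∈ Set.Ioc (0 : ℝ) 1,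
      eLpNorm (fun x => ‖x‖ ^ s • wavePacket φ v k g σ x) (ENNReal.ofReal q) volume ≤
        C * ENNReal.ofReal (σ ^ ((Module.finrank ℝ V : ℝ) / 2 - Module.finrank ℝ V / q - s)) := by
  obtain ⟨N, C₁, hC₁⟩ := exists_eLpNorm_norm_rpow_smul_le (volume : Measure V) (E := ℂ)
    (q := ENNReal.ofReal q) (by simpa using ENNReal.ofReal_le_ofReal hq2) hs
  obtain ⟨C₂, hC₂⟩ := exists_eLpNorm_two_one_add_norm_pow_smul_le φ N
    (continuous_const (y := (2 * Real.pi * ‖v‖) ^ k • g))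
  refine ⟨C₁ * C₂, fun σ hσ => ?_⟩
  let d : ℝ := Module.finrank ℝ V
  let F := wavePacket φ v k g σ
  let G := 𝓕⁻ (oscMul φ σ⁻¹ ((2 * Real.pi * ‖v‖) ^ k • g))
  have hF : eLpNorm (fun x => ‖x‖ ^ s • F x) (ENNReal.ofReal q) volume =
      ENNReal.ofReal (σ ^ (-d / q - s)) *
        eLpNorm (fun y => ‖y‖ ^ s • F (σ⁻¹ • y)) (ENNReal.ofReal q) volume := by
    rw [← eLpNorm_norm_rpow_smul_comp_smul volume hq0 s (fun y => F (σ⁻¹ • y)) hσ.1]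
    simp only [inv_smul_smul₀ hσ.1.ne']
  have hFG (y : V) : ‖F (σ⁻¹ • y)‖ ≤ ‖y‖ ^ k * ‖G (σ⁻¹ • y)‖ := by
    simpa only [smul_inv_smul₀ hσ.1.ne'] using
      norm_wavePacket_le φ v hσ.1.ne' k g (σ⁻¹ • y)
  have hG : eLpNorm (fun y => (1 + ‖y‖) ^ N • G (σ⁻¹ • y)) 2 volume ≤
      ENNReal.ofReal (σ ^ (d / 2)) * C₂ := by
    have h := eLpNorm_comp_smul volume two_pos (fun x => (1 + ‖σ • x‖) ^ N • G x)
      (inv_pos.mpr hσ.1)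
    simp only [smul_inv_smul₀ hσ.1.ne'] at h
    rw [ENNReal.ofReal_ofNat] at h
    rw [h, Real.inv_rpow hσ.1.le, ← Real.rpow_neg hσ.1.le, neg_div, neg_neg]
    gcongr
    exact hC₂ σ hσ
  calc _ = _ := hF
    _ ≤ ENNReal.ofReal (σ ^ (-d / q - s)) * (C₁ * (ENNReal.ofReal (σ ^ (d / 2)) * C₂)) := by
        gcongr
        exact (hC₁ _ _ (G.continuous.comp (continuous_const_smul σ⁻¹)).aestronglyMeasurable
          hFG).trans (by gcongr; exact hG)
    _ = ↑(C₁ * C₂) * ENNReal.ofReal (σ ^ (d / 2 - d / q - s)) := by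
        rw [show d / 2 - d / q - s = -d / q - s + d / 2 by ring, Real.rpow_add hσ.1,
          ENNReal.ofReal_mul (by have := hσ.1; positivity), ENNReal.coe_mul]
        ring

end WavePacket

section Cutoff

open scoped ContDiff

variable {V : Type*} [NormedAddCommGroup V] [InnerProductSpace ℝ V]

theorem exists_schwartz_eqOn_closedBall [FiniteDimensional ℝ V] {f : V → ℝ} {e : V} {r R : ℝ}
    (hr : 0 < r) (hrR : r < R) (hf : ∀ η ∈ Metric.closedBall e R, ContDiffAt ℝ ∞ f η) :
    ∃ g : 𝓢(V, ℝ), Set.EqOn g f (Metric.closedBall e r) := by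
  let B : ContDiffBump e := ⟨r, R, hr, hrR⟩
  have hB : ContDiff ℝ ∞ fun η => B η * f η := by
    refine contDiff_iff_contDiffAt.mpr fun η => ?_
    by_cases hη : η ∈ tsupport B
    · exact B.contDiffAt.mul (hf η (B.tsupport_eq ▸ hη))
    · refine (contDiffAt_const (c := 0)).congr_of_eventuallyEq ?_
      filter_upwards [notMem_tsupport_iff_eventuallyEq.mp hη] with y hy
      rw [hy, Pi.zero_apply, zero_mul]
  refine ⟨B.hasCompactSupport.mul_right.toSchwartzMap hB, fun η hη => ?_⟩
  exact (congrArg (· * f η) (B.one_of_mem_closedBall hη)).trans (one_mul _)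

theorem exists_schwartz_eqOn_norm_rpow [FiniteDimensional ℝ V] {e : V} (he : ‖e‖ = 1) (a : ℝ) :
    ∃ g : 𝓢(V, ℝ), Set.EqOn g (fun η => ‖η‖ ^ a) (Metric.closedBall e (1 / 2)) := by
  refine exists_schwartz_eqOn_closedBall (R := 3 / 4) (by norm_num) (by norm_num) fun η hη => ?_
  have hη0 : η ≠ 0 := by
    rintro rfl
    rw [mem_closedBall_iff_norm, zero_sub, norm_neg, he] at hη
    norm_num at hη
  exact (contDiffAt_norm ℝ hη0).rpow_const_of_ne (norm_ne_zero_iff.mpr hη0)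

theorem exists_schwartz_tsupport_subset_closedBall [FiniteDimensional ℝ V] (e : V) {r : ℝ}
    (hr : 0 < r) :
    ∃ χ : 𝓢(V, ℂ), tsupport χ ⊆ Metric.closedBall e r ∧ χ e = 1 := by
  let B : ContDiffBump e := ⟨r / 2, r, by linarith, by linarith⟩
  refine ⟨(B.hasCompactSupport.comp_left Complex.ofReal_zero).toSchwartzMap
    (Complex.ofRealCLM.contDiff.comp B.contDiff), ?_, ?_⟩
  · exact (tsupport_comp_subset Complex.ofReal_zero B).trans B.tsupport_eq.subset
  · exact congrArg Complex.ofReal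
      (B.one_of_mem_closedBall (Metric.mem_closedBall_self B.rIn_pos.le))

theorem lineDerivOp_eq_of_eventuallyEq_norm_rpow {φ : 𝓢(V, ℝ)} {e : V} (he : ‖e‖ = 1) {a : ℝ}
    (hφ : φ =ᶠ[𝓝 e] fun η => ‖η‖ ^ a) : ∂_{e} φ e = a := by
  have hline : Filter.Tendsto (fun t : ℝ => e + t • e) (𝓝 0) (𝓝 e) :=
    Continuous.tendsto' (by fun_prop) _ _ (by simp)
  have hev : (fun t : ℝ => φ (e + t • e)) =ᶠ[𝓝 0] fun t => (1 + t) ^ a := by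
    filter_upwards [hline.eventually hφ, lt_mem_nhds neg_one_lt_zero] with t ht ht1
    rw [ht, show e + t • e = (1 + t) • e by rw [add_smul, one_smul], norm_smul, he, mul_one,
      Real.norm_of_nonneg (by linarith)]
  have hderiv : HasDerivAt (fun t : ℝ => (1 + t) ^ a) a 0 := by
    simpa using ((hasDerivAt_id (0 : ℝ)).const_add 1).rpow_const (p := a) (Or.inl (by simp))
  rw [lineDerivOp_apply, lineDeriv, hev.deriv_eq, hderiv.deriv]

theorem iterate_twistedDeriv_ne_zero {φ : 𝓢(V, ℝ)} {e : V} (he : e ≠ 0) {σ : ℝ}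
    (hσ : σ ≠ 0 ∨ ∂_{e} φ e ≠ 0) {χ : 𝓢(V, ℂ)} (hχ : χ e ≠ 0) (k : ℕ) :
    (twistedDeriv φ e σ)^[k] χ ≠ 0 := by
  by_cases hσ0 : σ = 0
  · have hφ : ∂_{e} φ e ≠ 0 := hσ.resolve_left (not_not_intro hσ0)
    refine DFunLike.ne_iff.mpr ⟨e, ?_⟩
    rw [hσ0, iterate_twistedDeriv_zero_apply]
    simpa [hχ] using fun h => absurd h hφ
  · have hzero : (twistedDeriv φ e σ)^[k] 0 = 0 :=
      Function.iterate_fixed (by ext; simp [twistedDeriv_apply]) k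
    rw [← hzero]
    exact ((twistedDeriv_injective φ he hσ0).iterate k).ne (DFunLike.ne_iff.mpr ⟨e, hχ⟩)

end Cutoff

section PowerWeightedNorm

variable {n : ℕ}

theorem weightedNorm_norm_rpow {p : ℝ} (hp : 0 < p) (s : ℝ) (f : Rn n → ℂ) :
    weightedNorm p (fun x => ‖x‖ ^ (p * s)) f =
      eLpNorm (fun x => ‖x‖ ^ s • f x) (ENNReal.ofReal p) volume := by
  have hw : Measurable fun x : Rn n => ENNReal.ofReal (‖x‖ ^ (p * s)) := by fun_prop
  rw [weightedNorm, eLpNorm_eq_lintegral_rpow_enorm_toReal (by simpa using hp) (by simp),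
    eLpNorm_eq_lintegral_rpow_enorm_toReal (by simpa using hp) (by simp),
    lintegral_withDensity_eq_lintegral_mul_non_measurable _ hw (.of_forall fun _ => by simp)]
  simp only [Pi.mul_apply, enorm_smul, ENNReal.toReal_ofReal hp.le,
    ENNReal.mul_rpow_of_nonneg _ _ hp.le]
  congr! 4
  rw [Real.enorm_of_nonneg (by positivity), ENNReal.ofReal_rpow_of_nonneg (by positivity) hp.le,
    ← Real.rpow_mul (norm_nonneg _), mul_comm p]

theorem weightedNorm_norm_rpow_comp_smul {p : ℝ} (hp : 0 < p) (s : ℝ) (f : Rn n → ℂ) {c : ℝ}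
    (hc : 0 < c) :
    weightedNorm p (fun x => ‖x‖ ^ (p * s)) (fun x => f (c • x)) =
      ENNReal.ofReal (c ^ (-(n : ℝ) / p - s)) *
        eLpNorm (fun x => ‖x‖ ^ s • f x) (ENNReal.ofReal p) volume := by
  rw [weightedNorm_norm_rpow hp, eLpNorm_norm_rpow_smul_comp_smul volume hp s f hc,
    finrank_euclideanSpace_fin]

end PowerWeightedNorm

section Multiplier

variable {n : ℕ}

theorem angularFourier_comp_smul (F : Rn n → ℂ) {c : ℝ} (hc : 0 < c) (ξ : Rn n) :
    angularFourier (fun x => F (c • x)) ξ =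
      ((c ^ n)⁻¹ : ℝ) * 𝓕 F ((2 * Real.pi * c)⁻¹ • ξ) := by
  have h := Measure.integral_comp_smul_of_nonneg (volume : Measure (Rn n))
    (fun y => Complex.exp (-(Complex.I * ((c⁻¹ * inner ℝ y ξ : ℝ) : ℂ))) * F y) c (hR := hc.le)
  rw [finrank_euclideanSpace_fin, Complex.real_smul] at h
  rw [angularFourier_eq, Real.fourier_eq']
  convert! h using 3 with x
  · rw [real_inner_smul_left, inv_mul_cancel_left₀ hc.ne']
  · ext x
    rw [smul_eq_mul, real_inner_smul_right]
    congr 2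
    have : (Real.pi : ℂ) ≠ 0 := by exact_mod_cast Real.pi_ne_zero
    have : (c : ℂ) ≠ 0 := by exact_mod_cast hc.ne'
    push_cast
    field_simp

theorem multiplierOp_comp_smul (a F : Rn n → ℂ) {c : ℝ} (hc : 0 < c) (x : Rn n) :
    multiplierOp a (fun x => F (c • x)) x =
      𝓕⁻ (fun η => a ((2 * Real.pi * c) • η) * 𝓕 F η) (c • x) := by
  have hR : 0 < 2 * Real.pi * c := by positivity
  have h := Measure.integral_comp_smul_of_nonneg (volume : Measure (Rn n))
    (fun ξ => Complex.exp (Complex.I * ((inner ℝ x ξ : ℝ) : ℂ)) *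
      (a ξ * 𝓕 F ((2 * Real.pi * c)⁻¹ • ξ))) (2 * Real.pi * c) (hR := hR.le)
  rw [finrank_euclideanSpace_fin, Complex.real_smul] at h
  simp only [multiplierOp, Real.fourierInv_eq', angularFourier_comp_smul F hc, mul_left_comm _
    (((c ^ n)⁻¹ : ℝ) : ℂ)]
  rw [integral_const_mul, ← mul_assoc, ← Complex.ofReal_mul, ← mul_inv, ← mul_pow, ← h]
  congr 1
  ext η
  rw [inv_smul_smul₀ hR.ne', real_inner_smul_right, real_inner_smul_right, smul_eq_mul,
    real_inner_comm]
  congr 2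
  push_cast
  ring

theorem oscSymbol_smul (ρ m : ℝ) {R : ℝ} (hR : 0 < R) (η : Rn n) :
    oscSymbol n ρ m (R • η) = (R ^ m : ℝ) *
      (Complex.exp (Complex.I * (R ^ (1 - ρ) * ‖η‖ ^ (1 - ρ) : ℝ)) * (‖η‖ ^ m : ℝ)) := by
  rw [oscSymbol, norm_smul, Real.norm_of_nonneg hR.le, Real.mul_rpow hR.le (norm_nonneg _),
    Real.mul_rpow hR.le (norm_nonneg _)]
  push_cast
  ring

end Multiplier

section Order

variable {n : ℕ}

theorem ofReal_rpow_sub_mul_le {c : ℝ} (hc : 0 < c) {α β : ℝ} {A B C : ℝ≥0∞}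
    (h : ENNReal.ofReal (c ^ α) * A ≤ C * (ENNReal.ofReal (c ^ β) * B)) :
    ENNReal.ofReal (c ^ (α - β)) * A ≤ C * B := by
  rw [Real.rpow_sub hc, ENNReal.ofReal_div_of_pos (by positivity), ← ENNReal.mul_div_right_comm]
  refine ENNReal.div_le_of_le_mul (h.trans_eq ?_)
  ring

theorem exists_le_of_isWeightedBounded_norm_rpow {a : Rn n → ℂ} {q p s : ℝ} (hq : 0 < q)
    (hp : 0 < p)
    (ha : IsWeightedBounded a q p (fun x => ‖x‖ ^ (q * s)) (fun x => ‖x‖ ^ (p * s))) :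
    ∃ C : ℝ≥0, ∀ R : ℝ, 0 < R → ∀ F G : 𝓢(Rn n, ℂ), (∀ η, a (R • η) * 𝓕 F η = G η) →
      ENNReal.ofReal (R ^ ((n : ℝ) / q - n / p)) *
          eLpNorm (fun x => ‖x‖ ^ s • 𝓕⁻ G x) (ENNReal.ofReal p) volume ≤
        C * eLpNorm (fun x => ‖x‖ ^ s • F x) (ENNReal.ofReal q) volume := by
  obtain ⟨C, hC⟩ := ha
  refine ⟨C * ((2 * Real.pi) ^ ((n : ℝ) / q - n / p)).toNNReal, fun R hR F G hFG => ?_⟩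
  obtain ⟨c, rfl⟩ : ∃ c, R = 2 * Real.pi * c := ⟨R / (2 * Real.pi), by field_simp⟩
  have hc : 0 < c := pos_of_mul_pos_right hR Real.two_pi_pos.le
  let f : 𝓢(Rn n, ℂ) := compCLMOfContinuousLinearEquiv ℂ
    (ContinuousLinearEquiv.smulLeft (Units.mk0 c hc.ne')) F
  have hf : (f : Rn n → ℂ) = fun x => F (c • x) := rfl
  have hint : Integrable fun ξ => a ξ * angularFourier f ξ := by
    refine ((G.integrable.comp_smul (inv_ne_zero hR.ne')).const_mul
      (((c ^ n)⁻¹ : ℝ) : ℂ)).congr (.of_forall fun ξ => ?_)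
    simp only [hf, angularFourier_comp_smul F hc, ← hFG, smul_inv_smul₀ hR.ne', fourier_coe]
    ring
  have hop : multiplierOp a f = fun x => 𝓕⁻ G (c • x) := by
    ext x
    rw [hf, multiplierOp_comp_smul a F hc, fourierInv_coe, ← fourier_coe, funext hFG]
  have h := hC f hint
  rw [hop, hf, weightedNorm_norm_rpow_comp_smul hp s _ hc,
    weightedNorm_norm_rpow_comp_smul hq s _ hc] at h
  have hexp : (n : ℝ) / q - n / p = -(n : ℝ) / p - s - (-(n : ℝ) / q - s) := by ring
  rw [ENNReal.coe_mul, ← ENNReal.ofReal, Real.mul_rpow Real.two_pi_pos.le hc.le,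
    ENNReal.ofReal_mul (by positivity), mul_assoc, mul_comm (C : ℝ≥0∞), mul_assoc, hexp]
  exact mul_le_mul_right (ofReal_rpow_sub_mul_le hc h) _

theorem exists_oscSymbol_smul_mul_fourier_wavePacket {ρ : ℝ} (m : ℝ) (k : ℕ) {e : Rn n}
    (he : ‖e‖ = 1) :
    ∃ (φ : 𝓢(Rn n, ℝ)) (χ : 𝓢(Rn n, ℂ)) (g : ℝ → 𝓢(Rn n, ℂ)), Continuous g ∧
      (∀ σ, σ ≠ 0 ∨ ρ ≠ 1 → g σ ≠ 0) ∧
      ∀ R : ℝ, 0 < R → ∀ η, oscSymbol n ρ m (R • η) * 𝓕 (wavePacket φ e k χ (R ^ (ρ - 1))) η =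
        (R ^ m • g (R ^ (ρ - 1))) η := by
  have he0 : e ≠ 0 := norm_ne_zero_iff.mp (he ▸ one_ne_zero)
  obtain ⟨φ, hφ⟩ := exists_schwartz_eqOn_norm_rpow he (1 - ρ)
  obtain ⟨b, hb⟩ := exists_schwartz_eqOn_norm_rpow he m
  obtain ⟨χ, hχ, hχe⟩ := exists_schwartz_tsupport_subset_closedBall e (r := 1 / 2) (by norm_num)
  have hsupp (σ : ℝ) : Function.support ((twistedDeriv φ e σ)^[k] χ) ⊆
      Metric.closedBall e (1 / 2) := (support_iterate_twistedDeriv_subset φ e σ k χ).trans hχ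
  have hb_apply (g : 𝓢(Rn n, ℂ)) (η : Rn n) : smulLeftCLM ℂ b g η = b η * g η :=
    (smulLeftCLM_apply_apply b.hasTemperateGrowth g η).trans (Complex.real_smul)
  refine ⟨φ, χ, fun σ => smulLeftCLM ℂ b ((twistedDeriv φ e σ)^[k] χ),
    (smulLeftCLM ℂ b).continuous.comp (continuous_iterate_twistedDeriv φ e k χ),
    fun σ hσ h => ?_, fun R hR η => ?_⟩
  · have hφe : ∂_{e} φ e = 1 - ρ := lineDerivOp_eq_of_eventuallyEq_norm_rpow he
      (hφ.eventuallyEq_of_mem (Metric.closedBall_mem_nhds e (by norm_num)))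
    obtain ⟨η, hη⟩ := DFunLike.ne_iff.mp (iterate_twistedDeriv_ne_zero he0
      (hσ.imp_right fun hρ => by rw [hφe]; exact sub_ne_zero.mpr hρ.symm)
      (hχe ▸ one_ne_zero) k)
    have hη0 : η ≠ 0 := by
      rintro rfl
      have := hsupp σ hη
      rw [mem_closedBall_iff_norm, zero_sub, norm_neg, he] at this
      norm_num at this
    have hbη : smulLeftCLM ℂ b ((twistedDeriv φ e σ)^[k] χ) η = 0 := congrArg (· η) h
    rw [hb_apply, hb (hsupp σ hη)] at hbη
    have : 0 < ‖η‖ := norm_pos_iff.mpr hη0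
    exact mul_ne_zero (Complex.ofReal_ne_zero.mpr (by positivity)) hη hbη
  · rw [wavePacket, fourier_fourierInv_eq, oscMul_apply, smul_apply, Complex.real_smul, hb_apply]
    by_cases hη : (twistedDeriv φ e (R ^ (ρ - 1)))^[k] χ η = 0
    · simp only [hη, mul_zero]
    · have hσ : (R ^ (ρ - 1))⁻¹ = R ^ (1 - ρ) := by rw [← Real.rpow_neg hR.le, neg_sub]
      have hphase := Complex.exp_ne_zero (Complex.I * (R ^ (1 - ρ) * ‖η‖ ^ (1 - ρ) : ℝ))
      rw [oscSymbol_smul ρ m hR, hφ (hsupp _ hη), hb (hsupp _ hη), hσ, neg_mul, Complex.exp_neg]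
      field_simp

theorem eLpNorm_norm_rpow_smul_fourierInv_smul (p : ℝ≥0∞) (s : ℝ) {A : ℝ} (hA : 0 ≤ A)
    (G : 𝓢(Rn n, ℂ)) :
    eLpNorm (fun x => ‖x‖ ^ s • 𝓕⁻ (A • G) x) p volume =
      ENNReal.ofReal A * eLpNorm (fun x => ‖x‖ ^ s • 𝓕⁻ G x) p volume := by
  rw [← Real.enorm_of_nonneg hA, ← eLpNorm_const_smul]
  congr! 1
  ext x
  rw [FourierTransform.fourierInv_smul, smul_apply, Pi.smul_apply, smul_comm]

theorem exists_tendsto_rpow_sub_one {ρ : ℝ} (hρ : ρ ≤ 1) :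
    ∃ σ : ℝ, (σ ≠ 0 ∨ ρ ≠ 1) ∧ Filter.Tendsto (fun R : ℝ => R ^ (ρ - 1)) Filter.atTop (𝓝 σ) := by
  rcases hρ.lt_or_eq with hρ | rfl
  · exact ⟨0, .inr hρ.ne, by simpa using tendsto_rpow_neg_atTop (sub_pos.mpr hρ)⟩
  · exact ⟨1, .inl one_ne_zero, by simp⟩

theorem le_of_eventually_mul_ofReal_rpow_le {κ K : ℝ≥0∞} (hκ : κ ≠ 0) (hK : K ≠ ⊤) {α β : ℝ}
    (h : ∀ᶠ R : ℝ in Filter.atTop, κ * ENNReal.ofReal (R ^ α) ≤ K * ENNReal.ofReal (R ^ β)) :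
    α ≤ β := by
  by_contra! hlt
  have hlim : Filter.Tendsto (fun R : ℝ => κ * ENNReal.ofReal (R ^ (α - β))) Filter.atTop
      (𝓝 ⊤) := by
    rw [← ENNReal.mul_top hκ]
    exact ENNReal.Tendsto.const_mul
      (ENNReal.tendsto_ofReal_atTop.comp (tendsto_rpow_atTop (sub_pos.mpr hlt)))
      (.inl ENNReal.top_ne_zero)
  obtain ⟨R, hR, hRK, hR0⟩ := (h.and ((hlim.eventually (lt_mem_nhds hK.lt_top)).and
    (Filter.eventually_gt_atTop 0))).exists
  refine hRK.not_ge ?_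
  have hβ : 0 < R ^ β := Real.rpow_pos_of_pos hR0 β
  rw [Real.rpow_sub hR0, ENNReal.ofReal_div_of_pos hβ, ← mul_div_assoc]
  exact ENNReal.div_le_of_le_mul hR

theorem order_le_of_isWeightedBounded_norm_rpow (hn : 1 ≤ n) {p q ρ m s : ℝ} (hp : 0 < p)
    (hq0 : 0 < q) (hq2 : q ≤ 2) (hρ : ρ ≤ 1)
    (hb : IsWeightedBounded (oscSymbol n ρ m) q p
      (fun x => ‖x‖ ^ (q * s)) (fun x => ‖x‖ ^ (p * s))) :
    m ≤ n / p - n / q + (1 - ρ) * (s + n / q - n / 2) := by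
  have : Nonempty (Fin n) := ⟨⟨0, hn⟩⟩
  obtain ⟨e, he⟩ := exists_norm_eq (Rn n) zero_le_one
  let k := ⌈-s⌉₊
  have hk : 0 ≤ s + k := by linarith [Nat.le_ceil (-s)]
  obtain ⟨φ, χ, g, hg, hg0, hsymbol⟩ :=
    exists_oscSymbol_smul_mul_fourier_wavePacket (ρ := ρ) m k he
  obtain ⟨C, hC⟩ := exists_le_of_isWeightedBounded_norm_rpow hq0 hp hb
  obtain ⟨C', hC'⟩ := exists_eLpNorm_norm_rpow_smul_wavePacket_le φ e χ hq0 hq2 hk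
  obtain ⟨σ₀, hσ₀, hlim⟩ := exists_tendsto_rpow_sub_one hρ
  obtain ⟨κ, hκ, hκle⟩ := exists_eventually_le_eLpNorm_norm_rpow_smul (volume : Measure (Rn n))
    (p := ENNReal.ofReal p) (by simpa using hp) s
    ((fourierCLE ℂ 𝓢(Rn n, ℂ)).symm.continuous.comp hg)
    ((fourierCLE ℂ 𝓢(Rn n, ℂ)).symm.map_ne_zero_iff.mpr (hg0 σ₀ hσ₀))
  suffices h : n / q - n / p + m ≤ (ρ - 1) * (n / 2 - n / q - s) by linarith
  refine le_of_eventually_mul_ofReal_rpow_le hκ (K := ↑(C * C')) ENNReal.coe_ne_top ?_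
  filter_upwards [hlim.eventually hκle, Filter.eventually_ge_atTop 1] with R hκR hR
  have hR0 : 0 < R := by linarith
  have hσ : R ^ (ρ - 1) ∈ Set.Ioc (0 : ℝ) 1 :=
    ⟨by positivity, Real.rpow_le_one_of_one_le_of_nonpos hR (by linarith)⟩
  calc κ * ENNReal.ofReal (R ^ ((n : ℝ) / q - n / p + m))
      = ENNReal.ofReal (R ^ ((n : ℝ) / q - n / p)) * (ENNReal.ofReal (R ^ m) * κ) := by
        rw [Real.rpow_add hR0, ENNReal.ofReal_mul (by positivity)]
        ring
    _ ≤ ENNReal.ofReal (R ^ ((n : ℝ) / q - n / p)) *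
        eLpNorm (fun x => ‖x‖ ^ s • 𝓕⁻ (R ^ m • g (R ^ (ρ - 1))) x) (ENNReal.ofReal p) volume := by
        rw [eLpNorm_norm_rpow_smul_fourierInv_smul _ s (by positivity)]
        gcongr
        exact hκR
    _ ≤ C * (C' * ENNReal.ofReal ((R ^ (ρ - 1)) ^ ((n : ℝ) / 2 - n / q - s))) := by
        refine (hC R hR0 _ _ (hsymbol R hR0)).trans ?_
        gcongr
        simpa only [finrank_euclideanSpace_fin] using hC' _ hσ
    _ = ↑(C * C') * ENNReal.ofReal (R ^ ((ρ - 1) * ((n : ℝ) / 2 - n / q - s))) := by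
        rw [← Real.rpow_mul hR0.le, ENNReal.coe_mul, mul_assoc]

end Order

section ReverseHolder

theorem eLpNorm_norm_rpow_restrict_ball {V : Type*} [NormedAddCommGroup V] [NormedSpace ℝ V]
    [FiniteDimensional ℝ V] [MeasurableSpace V] [BorelSpace V] (μ : Measure V)
    [μ.IsAddHaarMeasure] {p : ℝ} (hp : 0 < p) (s : ℝ) {r : ℝ} (hr : 0 < r) :
    eLpNorm (fun x => ‖x‖ ^ s) (ENNReal.ofReal p) (μ.restrict (Metric.ball 0 r)) =
      ENNReal.ofReal (r ^ ((Module.finrank ℝ V : ℝ) / p + s)) *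
        eLpNorm (fun x => ‖x‖ ^ s) (ENNReal.ofReal p) (μ.restrict (Metric.ball 0 1)) := by
  classical
  have hind (r : ℝ) : (Metric.ball (0 : V) r).indicator (fun x => ‖x‖ ^ s) =
      fun x => ‖x‖ ^ s • (Metric.ball (0 : V) r).indicator (1 : V → ℝ) x := by
    ext x
    simp only [Set.indicator_apply, Pi.one_apply, smul_eq_mul, mul_ite, mul_one, mul_zero]
  have hball : (Metric.ball (0 : V) r).indicator (1 : V → ℝ) =
      fun x => (Metric.ball (0 : V) 1).indicator (1 : V → ℝ) (r⁻¹ • x) := by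
    ext x
    simp only [Set.indicator_apply, mem_ball_zero_iff, norm_smul, norm_inv,
      Real.norm_of_nonneg hr.le, inv_mul_lt_one₀ hr, Pi.one_apply]
  rw [← eLpNorm_indicator_eq_eLpNorm_restrict measurableSet_ball,
    ← eLpNorm_indicator_eq_eLpNorm_restrict measurableSet_ball, hind, hind, hball,
    eLpNorm_norm_rpow_smul_comp_smul μ hp s _ (inv_pos.mpr hr), Real.inv_rpow hr.le,
    ← Real.rpow_neg hr.le]
  ring_nf

theorem eLpNorm_norm_rpow_restrict_ball_lt_top {V : Type*} [NormedAddCommGroup V]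
    [NormedSpace ℝ V] [Nontrivial V] [FiniteDimensional ℝ V] [MeasurableSpace V] [BorelSpace V]
    (μ : Measure V) [μ.IsAddHaarMeasure] {p s : ℝ} (hp : 0 < p)
    (hs : -(Module.finrank ℝ V : ℝ) < s * p) (r : ℝ) :
    eLpNorm (fun x => ‖x‖ ^ s) (ENNReal.ofReal p) (μ.restrict (Metric.ball 0 r)) < ⊤ := by
  rw [eLpNorm_lt_top_iff_lintegral_rpow_enorm_lt_top (by simpa using hp) ENNReal.ofReal_ne_top,
    ENNReal.toReal_ofReal hp.le]
  have hint : IntegrableOn (fun x : V => ‖x‖ ^ (s * p)) (Metric.ball 0 r) μ := by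
    refine integrableOn_ball_of_norm_le_rpow (C := 1) (α := -(s * p)) Module.finrank_pos
      (by linarith) (.of_forall fun x => ?_) (Measurable.aestronglyMeasurable (by fun_prop))
    rw [one_mul, neg_neg, Real.norm_of_nonneg (by positivity)]
  refine (lintegral_congr fun x => ?_).trans_lt hint.lintegral_lt_top
  rw [Real.enorm_of_nonneg (by positivity), ENNReal.ofReal_rpow_of_nonneg (by positivity) hp.le,
    Real.rpow_mul (norm_nonneg x)]

variable {n : ℕ}

theorem cube_eq_preimage (c : Rn n) (ℓ : ℝ) :
    cube c ℓ = (WithLp.ofLp : Rn n → Fin n → ℝ) ⁻¹' Set.Icc c.ofLp (fun i => c i + ℓ) := by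
  ext x
  simp only [cube, Set.mem_ofPred_eq, Set.mem_Icc, Set.mem_preimage, Pi.le_def, forall_and]

theorem measurableSet_cube (c : Rn n) (ℓ : ℝ) : MeasurableSet (cube c ℓ) := by
  rw [cube_eq_preimage]
  exact (PiLp.volume_preserving_ofLp (Fin n)).measurable measurableSet_Icc

theorem volume_cube (c : Rn n) {ℓ : ℝ} (hℓ : 0 ≤ ℓ) :
    volume (cube c ℓ) = ENNReal.ofReal (ℓ ^ n) := by
  rw [cube_eq_preimage, (PiLp.volume_preserving_ofLp (Fin n)).measure_preimage
    measurableSet_Icc.nullMeasurableSet, Real.volume_Icc_pi]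
  simp [ENNReal.ofReal_pow hℓ]

theorem norm_sub_le_of_mem_cube {c x y : Rn n} {ℓ : ℝ} (hℓ : 0 ≤ ℓ) (hx : x ∈ cube c ℓ)
    (hy : y ∈ cube c ℓ) : ‖x - y‖ ≤ n * ℓ := by
  refine abs_le_of_sq_le_sq' ?_ (by positivity) |>.2
  rw [EuclideanSpace.real_norm_sq_eq]
  calc ∑ i, (x - y) i ^ 2 ≤ ∑ _i : Fin n, ℓ ^ 2 := by
        refine Finset.sum_le_sum fun i _ => sq_le_sq' ?_ ?_ <;>
          rw [PiLp.sub_apply] <;> linarith [(hx i).1, (hx i).2, (hy i).1, (hy i).2]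
    _ = n * ℓ ^ 2 := by simp
    _ ≤ (n * ℓ) ^ 2 := by
        rw [mul_pow]
        gcongr
        exact_mod_cast Nat.le_self_pow two_ne_zero n

theorem cubeMean_eq_setLAverage (t : ℝ) (w : Rn n → ℝ) (Q : Set (Rn n)) :
    cubeMean t w Q = (⨍⁻ x in Q, ENNReal.ofReal (w x) ^ t ∂volume) ^ (1 / t) := by
  rw [cubeMean, setLAverage_eq, ENNReal.div_eq_inv_mul]

theorem cubeMean_mono {t : ℝ} (ht : 0 < t) {v w : Rn n → ℝ} {Q : Set (Rn n)}
    (h : ∀ᵐ x ∂volume.restrict Q, v x ≤ w x) : cubeMean t v Q ≤ cubeMean t w Q := by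
  rw [cubeMean_eq_setLAverage, cubeMean_eq_setLAverage]
  refine ENNReal.rpow_le_rpow (laverage_mono_ae (h.mono fun x hx => ?_)) (by positivity)
  exact ENNReal.rpow_le_rpow (ENNReal.ofReal_le_ofReal hx) ht.le

theorem cubeMean_const {t : ℝ} (ht : 0 < t) (A : ℝ) (c : Rn n) {ℓ : ℝ} (hℓ : 0 < ℓ) :
    cubeMean t (fun _ => A) (cube c ℓ) = ENNReal.ofReal A := by
  have hvol := volume_cube c hℓ.le
  rw [cubeMean_eq_setLAverage, setLAverage_const (by simp [hvol, hℓ]) (by simp [hvol]),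
    ← ENNReal.rpow_mul, mul_one_div_cancel ht.ne', ENNReal.rpow_one]

theorem cubeMean_eq_eLpNorm {t : ℝ} (ht : 0 < t) {w : Rn n → ℝ} (hw : ∀ x, 0 ≤ w x)
    (Q : Set (Rn n)) :
    cubeMean t w Q =
      (volume Q)⁻¹ ^ (1 / t) * eLpNorm w (ENNReal.ofReal t) (volume.restrict Q) := by
  rw [eLpNorm_eq_lintegral_rpow_enorm_toReal (by simpa using ht) ENNReal.ofReal_ne_top,
    ENNReal.toReal_ofReal ht.le, ← ENNReal.mul_rpow_of_nonneg _ _ (by positivity)]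
  simp only [Real.enorm_of_nonneg (hw _), cubeMean]

theorem ofReal_rpow_le_cubeMean_norm_rpow [Nontrivial (Rn n)] {t s r : ℝ} (ht : 0 < t)
    (hs : s ≤ 0) (c : Rn n) {ℓ : ℝ} (hℓ : 0 < ℓ) (h : ∀ x ∈ cube c ℓ, ‖x‖ ≤ r) :
    ENNReal.ofReal (r ^ s) ≤ cubeMean t (fun x => ‖x‖ ^ s) (cube c ℓ) := by
  rw [← cubeMean_const ht (r ^ s) c hℓ]
  refine cubeMean_mono ht ?_
  filter_upwards [ae_restrict_mem (measurableSet_cube c ℓ),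
    ae_restrict_of_ae (volume.ae_ne (0 : Rn n))] with x hx hx0
  exact Real.rpow_le_rpow_of_nonpos (norm_pos_iff.mpr hx0) (h x hx) hs

theorem inv_mul_le_of_le {A x y C : ℝ≥0∞} (hA0 : A ≠ 0) (hAt : A ≠ ⊤) (hx : A ≤ x)
    (hy : y ≤ C * A) : x⁻¹ * y ≤ C := by
  calc x⁻¹ * y ≤ A⁻¹ * (C * A) := by gcongr
    _ = C := by rw [mul_left_comm, ENNReal.inv_mul_cancel hA0 hAt, mul_one]

theorem inv_cubeMean_one_mul_cubeMean_norm_rpow_le_of_norm_le [Nontrivial (Rn n)] {t s : ℝ}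
    (ht : 0 < t) (hs : s ≤ 0) {c : Rn n} {ℓ : ℝ} (hℓ : 0 < ℓ) (hc : ‖c‖ ≤ 2 * (n * ℓ)) :
    (cubeMean 1 (fun x => ‖x‖ ^ s) (cube c ℓ))⁻¹ * cubeMean t (fun x => ‖x‖ ^ s) (cube c ℓ) ≤
      ENNReal.ofReal ((4 * n) ^ ((n : ℝ) / t)) *
        eLpNorm (fun x : Rn n => ‖x‖ ^ s) (ENNReal.ofReal t)
          (volume.restrict (Metric.ball 0 1)) := by
  have hn : (0 : ℝ) < n := by
    simpa only [finrank_euclideanSpace_fin, Nat.cast_pos] using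
      Module.finrank_pos (R := ℝ) (M := Rn n)
  have hr : 0 < 4 * n * ℓ := by positivity
  have hlt (x) (hx : x ∈ cube c ℓ) : ‖x‖ < 4 * n * ℓ := by
    have := norm_sub_le_of_mem_cube hℓ.le hx (fun i => by simp [hℓ.le] : c ∈ cube c ℓ)
    nlinarith [norm_le_norm_add_norm_sub' x c]
  refine inv_mul_le_of_le (A := ENNReal.ofReal ((4 * n * ℓ) ^ s))
    (ENNReal.ofReal_pos.mpr (by positivity)).ne' ENNReal.ofReal_ne_top
    (ofReal_rpow_le_cubeMean_norm_rpow one_pos hs c hℓ fun x hx => (hlt x hx).le) ?_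
  have hvol : (volume (cube c ℓ))⁻¹ ^ (1 / t) = ENNReal.ofReal (ℓ ^ (-((n : ℝ) / t))) := by
    rw [volume_cube c hℓ.le, ← ENNReal.ofReal_inv_of_pos (by positivity),
      ENNReal.ofReal_rpow_of_pos (by positivity), ← Real.rpow_natCast, ← Real.rpow_neg hℓ.le,
      ← Real.rpow_mul hℓ.le, neg_mul, mul_one_div]
  have hpow : ℓ ^ (-((n : ℝ) / t)) * (4 * n * ℓ) ^ ((n : ℝ) / t + s) =
      (4 * n) ^ ((n : ℝ) / t) * (4 * n * ℓ) ^ s := by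
    rw [Real.rpow_add hr, Real.mul_rpow (by positivity) hℓ.le, Real.rpow_neg hℓ.le]
    field_simp
  calc cubeMean t (fun x => ‖x‖ ^ s) (cube c ℓ)
      ≤ (volume (cube c ℓ))⁻¹ ^ (1 / t) * eLpNorm (fun x : Rn n => ‖x‖ ^ s) (ENNReal.ofReal t)
          (volume.restrict (Metric.ball 0 (4 * n * ℓ))) := by
        rw [cubeMean_eq_eLpNorm ht fun x => by positivity]
        gcongr
        exact fun x hx => mem_ball_zero_iff.mpr (hlt x hx)
    _ = _ := by
        rw [eLpNorm_norm_rpow_restrict_ball volume ht s hr, hvol, finrank_euclideanSpace_fin,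
          ← mul_assoc, ← ENNReal.ofReal_mul (by positivity), hpow,
          ENNReal.ofReal_mul (by positivity), mul_right_comm]

theorem inv_cubeMean_one_mul_cubeMean_norm_rpow_le_of_le_norm [Nontrivial (Rn n)] {t s : ℝ}
    (ht : 0 < t) (hs : s ≤ 0) {c : Rn n} {ℓ : ℝ} (hℓ : 0 < ℓ) (hc : 2 * (n * ℓ) ≤ ‖c‖) :
    (cubeMean 1 (fun x => ‖x‖ ^ s) (cube c ℓ))⁻¹ * cubeMean t (fun x => ‖x‖ ^ s) (cube c ℓ) ≤
      ENNReal.ofReal (4 ^ (-s)) := by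
  have hn : (0 : ℝ) < n := by
    simpa only [finrank_euclideanSpace_fin, Nat.cast_pos] using
      Module.finrank_pos (R := ℝ) (M := Rn n)
  have hc0 : 0 < ‖c‖ := lt_of_lt_of_le (by positivity) hc
  have hdist (x) (hx : x ∈ cube c ℓ) : ‖x - c‖ ≤ ‖c‖ / 2 := by
    have := norm_sub_le_of_mem_cube hℓ.le hx (fun i => by simp [hℓ.le] : c ∈ cube c ℓ)
    linarith
  refine inv_mul_le_of_le (A := ENNReal.ofReal ((2 * ‖c‖) ^ s))
    (ENNReal.ofReal_pos.mpr (by positivity)).ne' ENNReal.ofReal_ne_top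
    (ofReal_rpow_le_cubeMean_norm_rpow one_pos hs c hℓ fun x hx => by
      linarith [hdist x hx, norm_le_norm_add_norm_sub' x c]) ?_
  have hpow : 4 ^ (-s) * (2 * ‖c‖) ^ s = (‖c‖ / 2) ^ s := by
    rw [show 2 * ‖c‖ = 4 * (‖c‖ / 2) by ring, Real.mul_rpow zero_le_four (by positivity),
      ← mul_assoc, ← Real.rpow_add zero_lt_four, neg_add_cancel, Real.rpow_zero, one_mul]
  rw [← ENNReal.ofReal_mul (by positivity), hpow, ← cubeMean_const ht ((‖c‖ / 2) ^ s) c hℓ]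
  refine cubeMean_mono ht (ae_restrict_of_forall_mem (measurableSet_cube c ℓ) fun x hx => ?_)
  exact Real.rpow_le_rpow_of_nonpos (by positivity)
    (by linarith [hdist x hx, norm_le_norm_add_norm_sub x c]) hs

theorem isReverseHolder_norm_rpow [Nontrivial (Rn n)] {t s : ℝ} (hs : s ≤ 0) (ht : 1 ≤ t)
    (hst : -(n : ℝ) < s * t) : IsReverseHolder t (fun x : Rn n => ‖x‖ ^ s) := by
  have ht0 : 0 < t := by linarith
  refine ⟨?_, ?_, ?_⟩
  · refine locallyIntegrable_of_norm_le_rpow (C := 1) (α := -s) Module.finrank_pos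
      (by rw [finrank_euclideanSpace_fin]; nlinarith) (.of_forall fun x => ?_)
      (Measurable.aestronglyMeasurable (by fun_prop))
    rw [one_mul, neg_neg, Real.norm_of_nonneg (by positivity)]
  · filter_upwards [volume.ae_ne (0 : Rn n)] with x hx
    exact Real.rpow_pos_of_pos (norm_pos_iff.mpr hx) s
  · have hK := eLpNorm_norm_rpow_restrict_ball_lt_top (volume : Measure (Rn n)) ht0
      (by simpa only [finrank_euclideanSpace_fin] using hst) 1
    refine lt_of_le_of_lt (iSup_le fun c => iSup_le fun ℓ => iSup_le fun hℓ => ?_)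
      (max_lt (ENNReal.mul_lt_top (ENNReal.ofReal_lt_top (r := (4 * n) ^ ((n : ℝ) / t))) hK)
        (ENNReal.ofReal_lt_top (r := 4 ^ (-s))))
    rcases le_total ‖c‖ (2 * (n * ℓ)) with hc | hc
    · exact (inv_cubeMean_one_mul_cubeMean_norm_rpow_le_of_norm_le ht0 hs hℓ hc).trans
        (le_max_left _ _)
    · exact (inv_cubeMean_one_mul_cubeMean_norm_rpow_le_of_le_norm ht0 hs hℓ hc).trans
        (le_max_right _ _)

end ReverseHolder

section Exponents

theorem inv_conjExponent {x : ℝ≥0∞} (hx : 1 ≤ x) : (ENNReal.conjExponent x)⁻¹ = 1 - x⁻¹ := by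
  have hconj := ENNReal.holderConjugate_iff.mp (ENNReal.HolderConjugate.conjExponent hx)
  exact ENNReal.eq_sub_of_add_eq (ENNReal.inv_ne_top.mpr (by positivity))
    ((add_comm _ _).trans hconj)

theorem mul_rhExponent {p q r : ℝ} (hp : 0 < p) (hq : q ≠ 0) (hr : 1 ≤ r)
    (hpr : 1 < 1 / p + 1 / r) : q * rhExponent p q r = (1 / p + 1 / r - 1)⁻¹ := by
  have hr0 : 0 < r := by linarith
  have hpr' : p * (1 - r⁻¹) < 1 := by
    rw [← lt_div_iff₀' hp, ← one_div]
    linarith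
  have hinv : (ENNReal.conjExponent (ENNReal.ofReal r) / ENNReal.ofReal p)⁻¹ =
      ENNReal.ofReal (p * (1 - r⁻¹)) := by
    rw [ENNReal.inv_div (.inl ENNReal.ofReal_ne_top) (.inl (by simpa using hp)),
      ENNReal.div_eq_inv_mul, inv_conjExponent (by simpa using hr), ← ENNReal.ofReal_one,
      ← ENNReal.ofReal_inv_of_pos hr0, ← ENNReal.ofReal_sub _ (by positivity), mul_comm,
      ← ENNReal.ofReal_mul hp.le]
  have hconj : 1 ≤ ENNReal.conjExponent (ENNReal.ofReal r) / ENNReal.ofReal p := by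
    rw [← ENNReal.inv_le_one, hinv, ENNReal.ofReal_le_one]
    exact hpr'.le
  have hnonneg : 0 ≤ p * (1 - r⁻¹) := mul_nonneg hp.le (sub_nonneg.mpr (inv_le_one_of_one_le₀ hr))
  rw [rhExponent, ← inv_inv (ENNReal.conjExponent (_ / _)), inv_conjExponent hconj, hinv,
    ← ENNReal.ofReal_one, ← ENNReal.ofReal_sub _ hnonneg, ENNReal.toReal_inv,
    ENNReal.toReal_ofReal (by linarith)]
  have : 1 / p + 1 / r - 1 ≠ 0 := by linarith
  have hfactor : 1 - p * (1 - r⁻¹) = p * (1 / p + 1 / r - 1) := by field_simp; ring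
  rw [hfactor]
  field_simp

theorem le_two_of_le_conjExponent {q : ℝ} (hq : 1 < q) (h : q ≤ Real.conjExponent q) : q ≤ 2 := by
  rw [Real.conjExponent, le_div_iff₀ (by linarith)] at h
  nlinarith

theorem one_lt_one_div_add_one_div {p q r : ℝ} (hq : 1 < q) (hp : 0 < p)
    (hpq : p ≤ Real.conjExponent q) (hr : 0 < r) (hrq : r < q) : 1 < 1 / p + 1 / r := by
  have hconj := (Real.HolderConjugate.conjExponent hq).inv_add_inv_eq_one
  calc 1 = 1 / Real.conjExponent q + 1 / q := by rw [one_div, one_div, add_comm, hconj]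
    _ ≤ 1 / p + 1 / q := by gcongr
    _ < 1 / p + 1 / r := by gcongr

end Exponents

section Necessity

variable {n : ℕ} {p q ρ m : ℝ}

theorem order_le_of_forall_Ioo_isWeightedBounded (hn : 1 ≤ n) (hp : 0 < p) (hq0 : 0 < q)
    (hq2 : q ≤ 2) (hρ : ρ ≤ 1) {γ : ℝ} (hγ : 0 < γ)
    (hb : ∀ s ∈ Set.Ioo (-(n : ℝ) / γ) 0, IsWeightedBounded (oscSymbol n ρ m) q p
      (fun x => ‖x‖ ^ (q * s)) (fun x => ‖x‖ ^ (p * s))) :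
    m ≤ -(n : ℝ) * (1 - ρ) * (1 / 2 - 1 / p) - ρ * n * (1 / q - 1 / p)
      - n * (1 - ρ) / γ := by
  have hn0 : (0 : ℝ) < n := by exact_mod_cast hn
  have hlt : -(n : ℝ) / γ < 0 := div_neg_of_neg_of_pos (neg_neg_of_pos hn0) hγ
  have hlim : Filter.Tendsto (fun s => n / p - n / q + (1 - ρ) * (s + n / q - n / 2))
      (𝓝[>] (-(n : ℝ) / γ)) (𝓝 (n / p - n / q + (1 - ρ) * (-(n : ℝ) / γ + n / q - n / 2))) :=
    (by fun_prop : Continuous _).continuousWithinAt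
  refine (ge_of_tendsto hlim ?_).trans_eq (by ring)
  filter_upwards [Ioo_mem_nhdsGT hlt] with s hs
  exact order_le_of_isWeightedBounded_norm_rpow hn hp hq0 hq2 hρ (hb s hs)

theorem one_le_rhExponent {r : ℝ} (hq : 0 < q) (hqp : q ≤ p) (hr : 1 ≤ r)
    (hpr : 1 < 1 / p + 1 / r) : 1 ≤ rhExponent p q r := by
  have hqp' : 1 / p ≤ 1 / q := one_div_le_one_div_of_le hq hqp
  have hr' : 1 / r ≤ 1 := (div_le_one (by linarith)).mpr hr
  refine le_of_mul_le_mul_left ?_ hq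
  rw [mul_one, mul_rhExponent (hq.trans_le hqp) hq.ne' hr hpr, le_inv_comm₀ hq (by linarith)]
  linarith [one_div q]

theorem isWeightedBounded_norm_rpow_of_forall_isReverseHolder (hn : 1 ≤ n) (hq : 0 < q) {t s : ℝ}
    (ht : 1 ≤ t) (hs : s ∈ Set.Ioo (-(n : ℝ) / (q * t)) 0) {a : Rn n → ℂ}
    (hb : ∀ ω : Rn n → ℝ, (∀ x, 0 ≤ ω x) → IsReverseHolder t (fun x => ω x ^ q) →
      IsWeightedBounded a q p (fun x => ω x ^ q) (fun x => ω x ^ p)) :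
    IsWeightedBounded a q p (fun x => ‖x‖ ^ (q * s)) (fun x => ‖x‖ ^ (p * s)) := by
  have : Nonempty (Fin n) := ⟨⟨0, hn⟩⟩
  have hpow (b : ℝ) : (fun x : Rn n => (‖x‖ ^ s) ^ b) = fun x => ‖x‖ ^ (b * s) := by
    ext x
    rw [← Real.rpow_mul (norm_nonneg x), mul_comm]
  have hst : -(n : ℝ) < q * s * t := by
    have := (div_lt_iff₀ (by positivity)).mp hs.1
    linarith
  simpa only [hpow] using hb (fun x => ‖x‖ ^ s) (fun x => by positivity)
    (by rw [hpow]; exact isReverseHolder_norm_rpow (mul_nonpos_of_nonneg_of_nonpos hq.le hs.2.le)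
          ht hst)

theorem order_le_of_forall_isReverseHolder (hn : 1 ≤ n) (hq0 : 0 < q)
    (hq2 : q ≤ 2) (hqp : q ≤ p) (hρ : ρ ≤ 1) {r : ℝ} (hr : 1 ≤ r) (hpr : 1 < 1 / p + 1 / r)
    (hb : ∀ ω : Rn n → ℝ, (∀ x, 0 ≤ ω x) →
      IsReverseHolder (rhExponent p q r) (fun x => ω x ^ q) →
      IsWeightedBounded (oscSymbol n ρ m) q p (fun x => ω x ^ q) (fun x => ω x ^ p)) :
    m ≤ -(n : ℝ) * (1 - ρ) * (1 / r - 1 / 2) - ρ * n * (1 / q - 1 / p) := by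
  have hp : 0 < p := hq0.trans_le hqp
  have ht : 1 ≤ rhExponent p q r := one_le_rhExponent hq0 hqp hr hpr
  have h := order_le_of_forall_Ioo_isWeightedBounded hn hp hq0 hq2 hρ
    (γ := q * rhExponent p q r) (by positivity)
    fun s hs => isWeightedBounded_norm_rpow_of_forall_isReverseHolder hn hq0 ht hs hb
  rw [mul_rhExponent hp hq0.ne' hr hpr, div_inv_eq_mul] at h
  exact h.trans_eq (by ring)

end Necessity

theorem proposition3p3_general (n : ℕ) (hn : 1 ≤ n) (p q ρ m : ℝ) (hq0 : 0 < q) (hq2 : q ≤ 2)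
    (hqp : q ≤ p) (hρ : ρ ≤ 1) :
    (∀ γ : ℝ, 0 < γ →
      (∀ s ∈ Set.Ioo (-(n : ℝ) / γ) 0,
        IsWeightedBounded (oscSymbol n ρ m) q p
          (fun x => ‖x‖ ^ (q * s)) (fun x => ‖x‖ ^ (p * s))) →
      m ≤ -(n : ℝ) * (1 - ρ) * (1 / 2 - 1 / p) - ρ * n * (1 / q - 1 / p)
        - n * (1 - ρ) / γ) ∧
    (∀ r : ℝ, 1 ≤ r → 1 < 1 / p + 1 / r →
      (∀ ω : Rn n → ℝ, (∀ x, 0 ≤ ω x) →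
        IsReverseHolder (rhExponent p q r) (fun x => ω x ^ q) →
        IsWeightedBounded (oscSymbol n ρ m) q p
          (fun x => ω x ^ q) (fun x => ω x ^ p)) →
      m ≤ -(n : ℝ) * (1 - ρ) * (1 / r - 1 / 2) - ρ * n * (1 / q - 1 / p)) :=
  ⟨fun _ => order_le_of_forall_Ioo_isWeightedBounded hn (hq0.trans_le hqp) hq0 hq2 hρ,
    fun _ => order_le_of_forall_isReverseHolder hn hq0 hq2 hqp hρ⟩

theorem proposition3p3 (n : ℕ) (hn : 1 ≤ n) (p q ρ m : ℝ) (hq : 1 < q) (hqp : q ≤ p)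
    (hpq : p ≤ Real.conjExponent q) (hρ0 : 0 < ρ) (hρ1 : ρ ≤ 1) :
    (∀ γ : ℝ, 1 ≤ γ →
      (∀ s ∈ Set.Ioo (-(n : ℝ) / γ) 0,
        IsWeightedBounded (oscSymbol n ρ m) q p
          (fun x => ‖x‖ ^ (q * s)) (fun x => ‖x‖ ^ (p * s))) →
      m ≤ -(n : ℝ) * (1 - ρ) * (1 / 2 - 1 / p) - ρ * n * (1 / q - 1 / p)
        - n * (1 - ρ) / γ) ∧
    (∀ r : ℝ, 1 ≤ r → r < q →
      (∀ ω : Rn n → ℝ, (∀ x, 0 ≤ ω x) →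
        IsReverseHolder (rhExponent p q r) (fun x => ω x ^ q) →
        IsWeightedBounded (oscSymbol n ρ m) q p
          (fun x => ω x ^ q) (fun x => ω x ^ p)) →
      m ≤ -(n : ℝ) * (1 - ρ) * (1 / r - 1 / 2) - ρ * n * (1 / q - 1 / p)) := by
  have hq2 : q ≤ 2 := le_two_of_le_conjExponent hq (hqp.trans hpq)
  obtain ⟨h₁, h₂⟩ := proposition3p3_general n hn p q ρ m (by linarith) hq2 hqp hρ1
  exact ⟨fun γ hγ => h₁ γ (by linarith), fun r hr hrq =>
    h₂ r hr (one_lt_one_div_add_one_div hq (by linarith) hpq (by linarith) hrq)⟩
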